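/- Let $\mathbb K$ be a field of characteristic zero and let $f\in\mathbb K[[x]]$ be unitary, i.e. $f(0)=0$ and $f'(0)=1$. Let $f^{-1}$ be its compositional inverse, let $D=d/dx$ on $\mathbb K[x]$, and let $Q=f^{-1}(D)$, that is $Q=\sum_n c_nD^n$ where $f^{-1}(t)=\sum_n c_nt^n$. Let $\phi\rightsquigarrow f^{-1}(D)$ be the umbral operator of $Q$: an invertible linear operator on $\mathbb K[x]$ whose polynomials $\phi_n=\phi x^n$ satisfy $\phi_0=1$, $\phi_n(0)=0$ for $n>0$, $Q\phi_0=0$ and $Q\phi_n=n\phi_{n-1}$ for $n>0$. For a linear operator $U$ on $\mathbb K[x]$ define its coefficients $\left[{n\atop k}\right]_U$ by $Ux^n=\sum_k\left[{n\atop k}\right]_Ux^k$. Write $\binom{s}{p}=s(s-1)\cdots(s-p+1)/p!$ for $s\in\mathbb K$, $p\in\mathbb N$. There is exactly one family $(f^s)_{s\in\mathbb K}$ of power series without constant term, whose coefficients are polynomial functions of $s$, such that $f^1=f$ and $f^r\circ f^s=f^{r+s}$ for all $r,s\in\mathbb K$ (the fractional iterates of $f$); let $f_*=\left.\frac{d f^s}{ds}\right|_{s=0}$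 be the iterative logarithm of $f$, the derivative being taken coefficientwise (each coefficient has a well-defined derivative, being a polynomial in $s$). Here $f^s(x)^k$ denotes the $k$-th power, in the ring $\mathbb K[[x]]$, of the $s$-th iterate. For all $s\in\mathbb K$ and $k\in\mathbb N=\{0,1,2,\dots\}$, $$\frac{f^s(x)^k}{k!}=\sum_{n=k}^\infty\frac{x^n}{n!}\sum_{p=0}^{n-k}\binom sp\left[{n\atop k}\right]_{(\phi-1)^p}=\sum_{n=k}^\infty\frac{x^n}{n!}\sum_{p=0}^{n-k}\binom sp\binom{n-k-s}{n-k-p}\left[{n\atop k}\right]_{\phi^p},$$ and $$f_*(x)=\sum_{n=2}^\infty\frac{x^n}{n!}\sum_{p=1}^{n-1}\frac{(-1)^{p-1}}{p}\left[{n\atop 1}\right]_{(\phi-1)^p}=\sum_{n=2}^\infty\frac{x^n}{n!}\sum_{p=1}^{n-1}\frac{(-1)^{p-1}}{p}\binom{n-1}{p}\left[{n\atop 1}\right]_{\phi^p}.$$ -/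

import Mathlib

noncomputable section

namespace Umbral

variable {K : Type*} [Field K]

/-- A formal power series `f` is unitary when `f(0) = 0` and `f'(0) = 1`. -/
structure IsUnitary (f : PowerSeries K) : Prop where
  constantCoeff_eq : PowerSeries.constantCoeff f = 0
  coeff_one_eq : PowerSeries.coeff 1 f = 1

theorem IsUnitary.isUnit_coeff_one {f : PowerSeries K} (hf : IsUnitary f) :
    IsUnit (PowerSeries.coeff 1 f) := by
  rw [hf.coeff_one_eq]; exact isUnit_one

/-- The compositional inverse `f⁻¹` of a unitary power series. -/
def IsUnitary.compInv {f : PowerSeries K} (hf : IsUnitary f) : PowerSeries K :=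
  f.substInvOfIsUnit hf.isUnit_coeff_one

theorem sum_derivative_eq (h : PowerSeries K) (p : Polynomial K) {N : ℕ}
    (hN : p.natDegree + 1 ≤ N) :
    ∑ n ∈ Finset.range (p.natDegree + 1),
        PowerSeries.coeff n h • (Polynomial.derivative^[n] p) =
      ∑ n ∈ Finset.range N, PowerSeries.coeff n h • (Polynomial.derivative^[n] p) := by
  refine Finset.sum_subset (Finset.range_mono hN) fun n _ hn => ?_
  rw [Polynomial.iterate_derivative_eq_zero (by simpa using hn), smul_zero]

/-- The operator `h(D) = ∑ₙ hₙ Dⁿ` on polynomials, where `D` is the derivative; applied to a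
polynomial the sum stops at the degree. -/
def opD (h : PowerSeries K) : Module.End K (Polynomial K) where
  toFun p := ∑ n ∈ Finset.range (p.natDegree + 1),
    PowerSeries.coeff n h • (Polynomial.derivative^[n] p)
  map_add' p q := by
    have hp : p.natDegree + 1 ≤ p.natDegree + q.natDegree + 1 := by omega
    have hq : q.natDegree + 1 ≤ p.natDegree + q.natDegree + 1 := by omega
    have hpq : (p + q).natDegree + 1 ≤ p.natDegree + q.natDegree + 1 := by
      have := Polynomial.natDegree_add_le p q
      omega
    rw [sum_derivative_eq h p hp, sum_derivative_eq h q hq, sum_derivative_eq h (p + q) hpq,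
      ← Finset.sum_add_distrib]
    simp [iterate_map_add]
  map_smul' c p := by
    rw [sum_derivative_eq h (c • p) (N := p.natDegree + 1)
      (Nat.succ_le_succ (Polynomial.natDegree_smul_le c p)), RingHom.id_apply, Finset.smul_sum]
    refine Finset.sum_congr rfl fun n _ => ?_
    rw [Polynomial.iterate_derivative_smul, smul_comm]

/-- `φ ⇝ Q`: the linear operator `φ` on polynomials is an umbral operator for `Q`. It is
invertible, its sequence `φₙ = φ xⁿ` satisfies `Q φ₀ = 0` and `Q φₙ = n φₙ₋₁` for `n > 0`,
`φ₀ = 1`, and `φₙ(0) = 0` for `n > 0`. -/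
structure IsUmbral (φ Q : Module.End K (Polynomial K)) : Prop where
  isUnit : IsUnit φ
  sheffer_zero : Q (φ (Polynomial.X ^ 0)) = 0
  sheffer_succ : ∀ n : ℕ,
    Q (φ (Polynomial.X ^ (n + 1))) = ((n + 1 : ℕ) : K) • φ (Polynomial.X ^ n)
  map_one : φ (Polynomial.X ^ 0) = 1
  eval_zero : ∀ n : ℕ, 0 < n → (φ (Polynomial.X ^ n)).eval 0 = 0

/-- The coefficient `[n, k]_U` of a linear operator `U` on polynomials:
`U xⁿ = ∑ₖ [n, k]_U xᵏ`. -/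
def opCoeff (U : Module.End K (Polynomial K)) (n k : ℕ) : K :=
  (U (Polynomial.X ^ n)).coeff k

/-- `F` is the family `(f ^ s)` of fractional iterates of `f`: power series without constant
term, with `f ^ 1 = f` and `f ^ r ∘ f ^ s = f ^ (r + s)`, whose coefficients are polynomials in
the exponent `s`. -/
structure IsFractionalIteration (f : PowerSeries K) (F : K → PowerSeries K) : Prop where
  constantCoeff_eq : ∀ s, PowerSeries.constantCoeff (F s) = 0
  one : F 1 = f
  comp : ∀ r s, PowerSeries.subst (F s) (F r) = F (r + s)
  polynomial : ∀ n, ∃ P : Polynomial K, ∀ s, PowerSeries.coeff n (F s) = P.eval s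

/-- `g` is the coefficientwise derivative at `s = 0` of the family `F`, whose coefficients are
polynomials in `s`. For the family of fractional iterates of `f` this is the iterative
logarithm of `f`. -/
def IsIterativeLog (F : K → PowerSeries K) (g : PowerSeries K) : Prop :=
  ∀ n, ∃ P : Polynomial K, (∀ s, PowerSeries.coeff n (F s) = P.eval s) ∧
    PowerSeries.coeff n g = P.derivative.eval 0

end Umbral

end

noncomputable section

namespace Umbral

open PowerSeries (coeff constantCoeff)

variable {K : Type*} [Field K]

/-! ### Composition of power series by coefficients -/

/-! The matrix of `φ` is that of composition with `f`, `[n, k]_φ = n!/k! · [xⁿ] f^k`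
(`IsUmbral.represents`), and operator products correspond to compositions of series
(`Represents.subst`). So `φ ^ m` carries the coefficients of `F m` for integers `m ≥ 1`. Since `φ -
1` lowers degrees, `φ ^ m = ∑ₚ (m choose p) (φ - 1) ^ p` is, entry by entry, a polynomial in `m` of
degree at most `n - k`. Coefficients of `F s ^ k` are polynomial in `s` too, so agreement at
positive integers gives the first formula for all `s`. The second is Lagrange interpolation of the
same polynomial at `0, …, n - k`, and the logarithms are the derivatives of both at `s = 0`.
Existence of `F` comes from taking the formula for `k = 1` as its definition. -/

theorem coeff_pow_eq_zero_of_lt {a : PowerSeries K} (ha : constantCoeff a = 0) {n d : ℕ}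
    (h : n < d) : coeff n (a ^ d) = 0 := by
  have hX : (PowerSeries.X : PowerSeries K) ^ d ∣ a ^ d :=
    pow_dvd_pow_of_dvd (PowerSeries.X_dvd_iff.mpr ha) d
  exact PowerSeries.X_pow_dvd_iff.mp hX n h

theorem coeff_subst_eq_sum {a : PowerSeries K} (ha : constantCoeff a = 0) (g : PowerSeries K)
    {n N : ℕ} (hN : n < N) :
    coeff n (g.subst a) = ∑ d ∈ Finset.range N, coeff d g * coeff n (a ^ d) := by
  rw [PowerSeries.coeff_subst' (PowerSeries.HasSubst.of_constantCoeff_zero' ha)]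
  refine finsum_eq_sum_of_support_subset _ fun d hd => ?_
  rw [Finset.coe_range, Set.mem_Iio]
  by_contra h
  exact hd (by simp [coeff_pow_eq_zero_of_lt ha (lt_of_lt_of_le hN (not_lt.mp h))])

theorem IsUnitary.coeff_pow_self {f : PowerSeries K} (hf : IsUnitary f) (n : ℕ) :
    coeff n (f ^ n) = 1 := by
  obtain ⟨u, rfl⟩ := PowerSeries.X_dvd_iff.mpr hf.constantCoeff_eq
  have hu := hf.coeff_one_eq
  rw [show (1 : ℕ) = 0 + 1 from rfl, PowerSeries.coeff_succ_X_mul,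
    PowerSeries.coeff_zero_eq_constantCoeff_apply] at hu
  rw [mul_pow]
  have := PowerSeries.coeff_X_pow_mul (u ^ n) n 0
  rw [zero_add] at this
  rw [this, PowerSeries.coeff_zero_eq_constantCoeff_apply, map_pow, hu, one_pow]

/-! ### The operators `h(D)` -/

theorem opD_apply_eq_sum (h : PowerSeries K) (p : Polynomial K) {N : ℕ} (hN : p.natDegree < N) :
    opD h p = ∑ n ∈ Finset.range N, coeff n h • (Polynomial.derivative^[n] p) :=
  sum_derivative_eq h p hN

theorem opD_apply_eq_aeval_trunc (h : PowerSeries K) (p : Polynomial K) {N : ℕ}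
    (hN : p.natDegree < N) :
    opD h p = Polynomial.aeval (Polynomial.derivative : Module.End K (Polynomial K))
      (PowerSeries.trunc N h) p := by
  rw [opD_apply_eq_sum h p hN, PowerSeries.trunc_apply, map_sum, LinearMap.sum_apply,
    Nat.Ico_zero_eq_range]
  refine Finset.sum_congr rfl fun n _ => ?_
  rw [Polynomial.aeval_monomial, Module.End.mul_apply, Module.algebraMap_end_apply,
    Module.End.pow_apply]

theorem aeval_derivative_eq_of_X_pow_dvd {P Q : Polynomial K} {N : ℕ}
    (hPQ : Polynomial.X ^ N ∣ P - Q) {p : Polynomial K} (hp : p.natDegree < N) :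
    Polynomial.aeval (Polynomial.derivative : Module.End K (Polynomial K)) P p =
      Polynomial.aeval (Polynomial.derivative : Module.End K (Polynomial K)) Q p := by
  obtain ⟨R, hR⟩ := hPQ
  rw [← sub_eq_zero, ← LinearMap.sub_apply, ← map_sub, hR, mul_comm, map_mul, map_pow,
    Polynomial.aeval_X, Module.End.mul_apply, Module.End.pow_apply,
    Polynomial.iterate_derivative_eq_zero hp, map_zero]

theorem natDegree_opD_le (h : PowerSeries K) (p : Polynomial K) :
    (opD h p).natDegree ≤ p.natDegree := by
  rw [opD_apply_eq_sum h p (Nat.lt_succ_self _)]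
  refine Polynomial.natDegree_sum_le_of_forall_le _ _ fun n _ => ?_
  exact (Polynomial.natDegree_smul_le _ _).trans
    ((Polynomial.natDegree_iterate_derivative p n).trans (Nat.sub_le _ _))

/-- On degrees below `N` only `h` modulo `x ^ N` matters, so this reduces to multiplicativity of
`Polynomial.aeval` at the derivative. -/
theorem opD_mul (g h : PowerSeries K) : opD (g * h) = opD g * opD h := by
  ext1 n
  ext1
  simp only [LinearMap.comp_apply, Module.End.mul_apply]
  set p : Polynomial K := Polynomial.monomial n 1
  have hp : p.natDegree < p.natDegree + 1 := Nat.lt_succ_self _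
  rw [opD_apply_eq_aeval_trunc g (opD h p) (Nat.lt_succ_of_le (natDegree_opD_le h p)),
    opD_apply_eq_aeval_trunc h p hp, opD_apply_eq_aeval_trunc (g * h) p hp,
    ← Module.End.mul_apply, ← map_mul]
  refine aeval_derivative_eq_of_X_pow_dvd ?_ hp
  rw [Polynomial.X_pow_dvd_iff]
  intro d hd
  rw [Polynomial.coeff_sub, PowerSeries.coeff_trunc, if_pos hd,
    PowerSeries.coeff_mul_eq_coeff_trunc_mul_trunc g h hd, ← Polynomial.coeff_coe,
    Polynomial.coe_mul, sub_self]

theorem opD_one : opD (1 : PowerSeries K) = 1 := by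
  refine LinearMap.ext fun p => ?_
  rw [opD_apply_eq_sum 1 p (Nat.lt_succ_self _), Finset.sum_eq_single 0]
  · simp
  · intro n _ hn
    rw [PowerSeries.coeff_one, if_neg hn, zero_smul]
  · simp

theorem opD_pow (h : PowerSeries K) (n : ℕ) : opD (h ^ n) = opD h ^ n := by
  induction n with
  | zero => rw [pow_zero, pow_zero, opD_one]
  | succ n ih => rw [pow_succ, pow_succ, opD_mul, ih]

theorem coeff_zero_opD (h : PowerSeries K) (p : Polynomial K) {N : ℕ} (hN : p.natDegree < N) :
    (opD h p).coeff 0 =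
      ∑ m ∈ Finset.range N, coeff m h * ((m.factorial : K) * p.coeff m) := by
  rw [opD_apply_eq_sum h p hN, Polynomial.finsetSum_coeff]
  refine Finset.sum_congr rfl fun m _ => ?_
  rw [Polynomial.coeff_smul, smul_eq_mul, Polynomial.coeff_iterate_derivative, zero_add,
    Nat.descFactorial_self, nsmul_eq_mul]

/-- The expansion `g(q(D)) = ∑ g_d q(D)^d` followed by evaluation at `0`, which is all that is
needed to read off coefficients. -/
theorem coeff_zero_opD_subst {q : PowerSeries K} (hq : constantCoeff q = 0) (g : PowerSeries K)
    (p : Polynomial K) {N : ℕ} (hN : p.natDegree < N) :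
    (opD (g.subst q) p).coeff 0 =
      ∑ d ∈ Finset.range N, coeff d g * ((opD q ^ d) p).coeff 0 := by
  rw [coeff_zero_opD _ p hN]
  simp_rw [← opD_pow, coeff_zero_opD _ p hN, Finset.mul_sum]
  rw [Finset.sum_comm]
  refine Finset.sum_congr rfl fun m hm => ?_
  rw [coeff_subst_eq_sum hq g (Finset.mem_range.mp hm), Finset.sum_mul]
  exact Finset.sum_congr rfl fun d _ => mul_assoc _ _ _

/-! ### Coefficients of an umbral operator -/

/-- The operator `U` has the exponential generating function `∑ₙ (U xⁿ) tⁿ / n! = exp (x a(t))`,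
stated by coefficients. -/
def Represents (a : PowerSeries K) (U : Module.End K (Polynomial K)) : Prop :=
  ∀ n k : ℕ, opCoeff U n k = (n.factorial : K) * (k.factorial : K)⁻¹ * coeff n (a ^ k)

theorem IsUmbral.coeff_zero_pow_apply {φ Q : Module.End K (Polynomial K)} (hφ : IsUmbral φ Q)
    (n d : ℕ) :
    ((Q ^ d) (φ (Polynomial.X ^ n))).coeff 0 = if d = n then (n.factorial : K) else 0 := by
  induction d generalizing n with
  | zero =>
    rw [pow_zero, Module.End.one_apply]
    rcases Nat.eq_zero_or_pos n with rfl | hn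
    · rw [hφ.map_one]; simp
    · rw [if_neg hn.ne, Polynomial.coeff_zero_eq_eval_zero, hφ.eval_zero n hn]
  | succ d ih =>
    rw [pow_succ, Module.End.mul_apply]
    cases n with
    | zero => rw [hφ.sheffer_zero, map_zero]; simp
    | succ n =>
      rw [hφ.sheffer_succ, map_smul, Polynomial.coeff_smul, ih, smul_eq_mul]
      by_cases h : d = n
      · rw [if_pos h, if_pos (by rw [h]), Nat.factorial_succ, Nat.cast_mul]
      · rw [if_neg h, if_neg (by omega), mul_zero]

/-- Expand `D ^ k = f(Q)^k` in powers of `Q`, apply it to `φ xⁿ` and evaluate at `0`: the left side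
gives `k!` times the coefficient of `x^k`, and on the right only `Q ^ n` survives, with value `n!`.
-/
theorem IsUmbral.represents [CharZero K] {f : PowerSeries K} (hf : IsUnitary f)
    {φ : Module.End K (Polynomial K)} (hφ : IsUmbral φ (opD hf.compInv)) :
    Represents f φ := by
  intro n k
  have hk0 : (k.factorial : K) ≠ 0 := Nat.cast_ne_zero.mpr k.factorial_ne_zero
  set p := φ (Polynomial.X ^ n) with hp
  -- Large enough for the surviving indices `k` and `n` to lie in the range.
  set N := p.natDegree + n + k + 1 with hN
  have hpN : p.natDegree < N := by omega
  have hq : constantCoeff hf.compInv = 0 := PowerSeries.constantCoeff_substInvOfIsUnit _ _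
  have hsub : (f ^ k).subst hf.compInv = PowerSeries.X ^ k := by
    rw [PowerSeries.subst_pow (PowerSeries.HasSubst.of_constantCoeff_zero' hq)]
    congr 1
    exact PowerSeries.subst_substInvOfIsUnit_right _ hf.constantCoeff_eq _
  have h₁ := coeff_zero_opD_subst hq (f ^ k) p hpN
  rw [hsub, coeff_zero_opD _ p hpN, Finset.sum_eq_single k] at h₁
  · rw [PowerSeries.coeff_X_pow_self, one_mul, Finset.sum_eq_single n] at h₁
    · rw [hp, hφ.coeff_zero_pow_apply, if_pos rfl] at h₁
      rw [opCoeff, mul_right_comm, ← div_eq_mul_inv, eq_div_iff hk0, mul_comm, h₁, mul_comm]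
    · intro d _ hd
      rw [hp, hφ.coeff_zero_pow_apply, if_neg hd, mul_zero]
    · intro h
      exact absurd (Finset.mem_range.mpr (by omega)) h
  · intro d _ hd
    rw [PowerSeries.coeff_X_pow, if_neg hd, zero_mul]
  · intro h
    exact absurd (Finset.mem_range.mpr (by omega)) h

/-- `U` lowers degrees by at least `e`. -/
def Lowers (e : ℕ) (U : Module.End K (Polynomial K)) : Prop :=
  ∀ n k : ℕ, n < k + e → opCoeff U n k = 0

theorem opCoeff_mul {V : Module.End K (Polynomial K)} (hV : Lowers 0 V)
    (U : Module.End K (Polynomial K)) (n k : ℕ) :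
    opCoeff (U * V) n k = ∑ d ∈ Finset.range (n + 1), opCoeff V n d * opCoeff U d k := by
  have hdeg : (V (Polynomial.X ^ n)).natDegree < n + 1 :=
    Nat.lt_succ_of_le (Polynomial.natDegree_le_iff_coeff_eq_zero.mpr fun k hk => hV n k (by omega))
  rw [opCoeff, Module.End.mul_apply, Polynomial.as_sum_range' _ _ hdeg, map_sum,
    Polynomial.finsetSum_coeff]
  refine Finset.sum_congr rfl fun d _ => ?_
  rw [← Polynomial.smul_X_eq_monomial, map_smul, Polynomial.coeff_smul, smul_eq_mul, opCoeff,
    opCoeff]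

theorem opCoeff_one (n k : ℕ) :
    opCoeff (1 : Module.End K (Polynomial K)) n k = if k = n then 1 else 0 := by
  rw [opCoeff, Module.End.one_apply, Polynomial.coeff_X_pow]

theorem lowers_one : Lowers 0 (1 : Module.End K (Polynomial K)) := fun n k h => by
  rw [opCoeff_one, if_neg (by omega)]

theorem Lowers.mono {e e' : ℕ} {U : Module.End K (Polynomial K)} (hU : Lowers e U)
    (h : e' ≤ e) : Lowers e' U := fun n k hnk => hU n k (by omega)

theorem Lowers.mul {d e : ℕ} {U V : Module.End K (Polynomial K)} (hU : Lowers d U)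
    (hV : Lowers e V) : Lowers (d + e) (U * V) := fun n k hnk => by
  rw [opCoeff_mul (hV.mono (Nat.zero_le _))]
  refine Finset.sum_eq_zero fun j _ => ?_
  by_cases hj : n < j + e
  · rw [hV n j hj, zero_mul]
  · rw [hU j k (by omega), mul_zero]

theorem Lowers.pow {U : Module.End K (Polynomial K)} (hU : Lowers 1 U) (p : ℕ) :
    Lowers p (U ^ p) := by
  induction p with
  | zero => rw [pow_zero]; exact lowers_one
  | succ p ih => rw [pow_succ]; exact ih.mul hU

theorem Represents.lowers {a : PowerSeries K} (ha : constantCoeff a = 0)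
    {U : Module.End K (Polynomial K)} (hU : Represents a U) : Lowers 0 U := fun n k h => by
  rw [hU, coeff_pow_eq_zero_of_lt ha (by omega), mul_zero]

/-- The matrix is triangular, and `f'(0) = 1` makes its diagonal `1`. -/
theorem Represents.lowers_sub_one [CharZero K] {f : PowerSeries K} (hf : IsUnitary f)
    {U : Module.End K (Polynomial K)} (hU : Represents f U) : Lowers 1 (U - 1) := fun n k h => by
  have hsub : opCoeff (U - 1) n k = opCoeff U n k - opCoeff 1 n k := by
    simp [opCoeff]
  have hn : (n.factorial : K) ≠ 0 := Nat.cast_ne_zero.mpr n.factorial_ne_zero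
  rw [hsub, opCoeff_one]
  by_cases hkn : k = n
  · subst hkn
    rw [hU, hf.coeff_pow_self, if_pos rfl, mul_one, mul_inv_cancel₀ hn, sub_self]
  · rw [if_neg hkn, hU.lowers hf.constantCoeff_eq n k (by omega), sub_zero]

theorem represents_X [CharZero K] : Represents (PowerSeries.X : PowerSeries K) 1 := fun n k => by
  have hn : (n.factorial : K) ≠ 0 := Nat.cast_ne_zero.mpr n.factorial_ne_zero
  rw [opCoeff_one, PowerSeries.coeff_X_pow]
  by_cases h : k = n
  · subst h
    simp [hn]
  · rw [if_neg h, if_neg (Ne.symm h), mul_zero]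

/-- Expanding `b(a)^k` in powers of `a` is a matrix product; the inner factorials `d!` cancel. -/
theorem Represents.subst [CharZero K] {a b : PowerSeries K} (ha : constantCoeff a = 0)
    {U V : Module.End K (Polynomial K)} (hU : Represents a U) (hV : Represents b V) :
    Represents (b.subst a) (V * U) := fun n k => by
  rw [opCoeff_mul (hU.lowers ha),
    ← PowerSeries.subst_pow (PowerSeries.HasSubst.of_constantCoeff_zero' ha),
    coeff_subst_eq_sum ha _ (Nat.lt_succ_self n), Finset.mul_sum]
  refine Finset.sum_congr rfl fun d _ => ?_
  have hd : (d.factorial : K) ≠ 0 := Nat.cast_ne_zero.mpr d.factorial_ne_zero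
  rw [hU, hV]
  field_simp

theorem Represents.unique [CharZero K] {a b : PowerSeries K} {U : Module.End K (Polynomial K)}
    (ha : Represents a U) (hb : Represents b U) : a = b := by
  ext n
  have hn : (n.factorial : K) ≠ 0 := Nat.cast_ne_zero.mpr n.factorial_ne_zero
  have h := (ha n 1).symm.trans (hb n 1)
  simpa [hn] using h

/-! ### Binomial polynomials -/

/-- The polynomial `X (X - 1) ⋯ (X - p + 1) / p!`. -/
def choosePoly (K : Type*) [Field K] (p : ℕ) : Polynomial K :=
  Polynomial.C (p.factorial : K)⁻¹ * descPochhammer K p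

theorem eval_choosePoly [CharZero K] (p : ℕ) (s : K) :
    (choosePoly K p).eval s = Ring.choose s p := by
  rw [Ring.choose_eq_smul, choosePoly, Polynomial.eval_mul, Polynomial.eval_C, smul_eq_mul,
    ← descPochhammer_map (Int.castRingHom K), Polynomial.eval_map,
    ← Polynomial.eval₂_smulOneHom_eq_smeval]
  congr 2
  exact RingHom.ext_int _ _

theorem natDegree_choosePoly_le (p : ℕ) : (choosePoly K p).natDegree ≤ p := by
  refine (Polynomial.natDegree_C_mul_le _ _).trans ?_
  rw [descPochhammer_natDegree]

theorem eval_zero_choosePoly_succ (p : ℕ) : (choosePoly K (p + 1)).eval 0 = 0 := by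
  rw [choosePoly, Polynomial.eval_mul, descPochhammer_ne_zero_eval_zero _ (Nat.succ_ne_zero p),
    mul_zero]

theorem choosePoly_zero : choosePoly K 0 = 1 := by
  simp [choosePoly]

theorem eval_neg_one_descPochhammer (p : ℕ) :
    (descPochhammer K p).eval (-1) = (-1) ^ p * (p.factorial : K) := by
  induction p with
  | zero => simp
  | succ p ih =>
    rw [descPochhammer_succ_eval, ih, Nat.factorial_succ]
    push_cast
    ring

/-- Splitting off the factor `X`, the derivative at `0` is the value of the cofactor there, a
falling factorial at `-1`. -/
theorem eval_zero_derivative_choosePoly_succ [CharZero K] (p : ℕ) :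
    (Polynomial.derivative (choosePoly K (p + 1))).eval 0 = (-1) ^ p / ((p + 1 : ℕ) : K) := by
  have hp : (p.factorial : K) ≠ 0 := Nat.cast_ne_zero.mpr p.factorial_ne_zero
  have hp1 : ((p + 1 : ℕ) : K) ≠ 0 := Nat.cast_ne_zero.mpr p.succ_ne_zero
  rw [choosePoly, descPochhammer_succ_left, Polynomial.derivative_C_mul, Polynomial.derivative_mul,
    Polynomial.derivative_X, Polynomial.eval_mul, Polynomial.eval_C, Polynomial.eval_add,
    Polynomial.eval_mul, Polynomial.eval_mul, Polynomial.eval_X, zero_mul, add_zero,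
    Polynomial.eval_one, one_mul, Polynomial.eval_comp, Polynomial.eval_sub, Polynomial.eval_X,
    Polynomial.eval_one, zero_sub, eval_neg_one_descPochhammer, Nat.factorial_succ, Nat.cast_mul]
  field_simp

/-! ### The coefficients of `φ ^ s` as polynomials in `s` -/

/-- The coefficients of `φ ^ s = ∑ₚ (s choose p) (φ - 1) ^ p`, as polynomials in `s`. -/
def deltaPoly (φ : Module.End K (Polynomial K)) (n k : ℕ) : Polynomial K :=
  ∑ p ∈ Finset.Icc 0 (n - k), choosePoly K p * Polynomial.C (opCoeff ((φ - 1) ^ p) n k)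

/-- The polynomial in `s` of degree at most `n - k` that interpolates the coefficients of the
powers `φ ^ p`, `p ≤ n - k`. -/
def powPoly (φ : Module.End K (Polynomial K)) (n k : ℕ) : Polynomial K :=
  ∑ p ∈ Finset.Icc 0 (n - k), choosePoly K p *
    (choosePoly K (n - k - p)).comp (Polynomial.C ((n : K) - k) - Polynomial.X) *
      Polynomial.C (opCoeff (φ ^ p) n k)

theorem eval_deltaPoly [CharZero K] (φ : Module.End K (Polynomial K)) (n k : ℕ) (s : K) :
    (deltaPoly φ n k).eval s =
      ∑ p ∈ Finset.Icc 0 (n - k), Ring.choose s p * opCoeff ((φ - 1) ^ p) n k := by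
  simp [deltaPoly, Polynomial.eval_finsetSum, eval_choosePoly]

theorem eval_powPoly [CharZero K] (φ : Module.End K (Polynomial K)) (n k : ℕ) (s : K) :
    (powPoly φ n k).eval s =
      ∑ p ∈ Finset.Icc 0 (n - k), Ring.choose s p * Ring.choose ((n : K) - k - s) (n - k - p) *
        opCoeff (φ ^ p) n k := by
  simp [powPoly, Polynomial.eval_finsetSum, eval_choosePoly]

theorem eval_deltaPoly_natCast [CharZero K] {φ : Module.End K (Polynomial K)}
    (hφ : Lowers 1 (φ - 1)) (n k m : ℕ) :
    (deltaPoly φ n k).eval (m : K) = opCoeff (φ ^ m) n k := by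
  have hpow : opCoeff (φ ^ m) n k =
      ∑ p ∈ Finset.range (m + 1), (m.choose p : K) * opCoeff ((φ - 1) ^ p) n k := by
    conv_lhs => rw [← sub_add_cancel φ 1, (Commute.one_right (φ - 1)).add_pow]
    rw [opCoeff, LinearMap.sum_apply, Polynomial.finsetSum_coeff]
    refine Finset.sum_congr rfl fun p _ => ?_
    rw [one_pow, mul_one, ← nsmul_eq_mul', LinearMap.smul_apply, Polynomial.coeff_smul,
      nsmul_eq_mul, opCoeff]
  rw [eval_deltaPoly, hpow]
  simp_rw [Ring.choose_natCast]
  -- Both sums extend to a common range: the binomial vanishes for `p > m`, the entry of `(φ - 1) ^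
  -- p` for `p > n - k`.
  have h₁ : Finset.Icc 0 (n - k) ⊆ Finset.range (m + (n - k) + 1) := fun p hp => by
    rw [Finset.mem_Icc] at hp
    exact Finset.mem_range.mpr (by omega)
  have h₂ : Finset.range (m + 1) ⊆ Finset.range (m + (n - k) + 1) :=
    Finset.range_mono (by omega)
  rw [Finset.sum_subset h₁, Finset.sum_subset h₂]
  · intro p _ hp
    rw [Finset.mem_range] at hp
    rw [Nat.choose_eq_zero_of_lt (by omega), Nat.cast_zero, zero_mul]
  · intro p _ hp
    rw [Finset.mem_Icc] at hp
    rw [hφ.pow p n k (by omega), mul_zero]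

theorem natDegree_deltaPoly_le (φ : Module.End K (Polynomial K)) (n k : ℕ) :
    (deltaPoly φ n k).natDegree ≤ n - k := by
  refine Polynomial.natDegree_sum_le_of_forall_le _ _ fun p hp => ?_
  exact (Polynomial.natDegree_mul_C_le _ _).trans
    ((natDegree_choosePoly_le p).trans (Finset.mem_Icc.mp hp).2)

theorem natDegree_powPoly_le (φ : Module.End K (Polynomial K)) (n k : ℕ) :
    (powPoly φ n k).natDegree ≤ n - k := by
  refine Polynomial.natDegree_sum_le_of_forall_le _ _ fun p hp => ?_
  have hlin : (Polynomial.C ((n : K) - k) - Polynomial.X).natDegree ≤ 1 :=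
    (Polynomial.natDegree_sub_le _ _).trans
      (max_le ((Polynomial.natDegree_C _).trans_le zero_le_one) Polynomial.natDegree_X_le)
  have hcomp : ((choosePoly K (n - k - p)).comp
      (Polynomial.C ((n : K) - k) - Polynomial.X)).natDegree ≤ n - k - p :=
    Polynomial.natDegree_comp_le.trans
      ((Nat.mul_le_mul (natDegree_choosePoly_le _) hlin).trans (mul_one _).le)
  refine (Polynomial.natDegree_mul_C_le _ _).trans (Polynomial.natDegree_mul_le.trans ?_)
  have := natDegree_choosePoly_le (K := K) p
  have := (Finset.mem_Icc.mp hp).2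
  omega

/-- The weights form a Lagrange basis: at `s = m` the first binomial kills `p > m`, the second kills
`p < m`. -/
theorem eval_powPoly_natCast [CharZero K] (φ : Module.End K (Polynomial K)) {n k m : ℕ}
    (hkn : k ≤ n) (hm : m ≤ n - k) : (powPoly φ n k).eval (m : K) = opCoeff (φ ^ m) n k := by
  have hcast : (n : K) - k - m = ((n - k - m : ℕ) : K) := by
    rw [Nat.cast_sub hm, Nat.cast_sub hkn]
  rw [eval_powPoly, hcast, Finset.sum_eq_single m]
  · rw [Ring.choose_natCast, Ring.choose_natCast, Nat.choose_self, Nat.choose_self]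
    simp
  · intro p hp hpm
    rw [Finset.mem_Icc] at hp
    rw [Ring.choose_natCast, Ring.choose_natCast]
    rcases lt_or_gt_of_ne hpm with h | h
    · rw [Nat.choose_eq_zero_of_lt (n := n - k - m) (by omega)]; simp
    · rw [Nat.choose_eq_zero_of_lt (n := m) h]; simp
  · intro h
    exact absurd (Finset.mem_Icc.mpr ⟨Nat.zero_le _, hm⟩) h

/-- Both have degree at most `n - k` and agree at the `n - k + 1` nodes `0, …, n - k`. -/
theorem powPoly_eq_deltaPoly [CharZero K] {φ : Module.End K (Polynomial K)}
    (hφ : Lowers 1 (φ - 1)) {n k : ℕ} (hkn : k ≤ n) : powPoly φ n k = deltaPoly φ n k := by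
  classical
  set S : Finset K := (Finset.range (n - k + 1)).image Nat.cast
  have hS : S.card = n - k + 1 := by
    rw [Finset.card_image_of_injective _ Nat.cast_injective, Finset.card_range]
  refine Polynomial.eq_of_degree_sub_lt_of_eval_finset_eq S ?_ ?_
  · rw [hS]
    refine Polynomial.degree_le_natDegree.trans_lt (Nat.cast_lt.mpr (Nat.lt_succ_of_le ?_))
    exact (Polynomial.natDegree_sub_le _ _).trans
      (max_le (natDegree_powPoly_le φ n k) (natDegree_deltaPoly_le φ n k))
  · intro x hx
    obtain ⟨m, hm, rfl⟩ := Finset.mem_image.mp hx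
    rw [eval_powPoly_natCast φ hkn (by rw [Finset.mem_range] at hm; omega),
      eval_deltaPoly_natCast hφ]

/-! ### Polynomial functions -/

/-- `u` is given by a polynomial. -/
def IsPolyFun (u : K → K) : Prop := ∃ P : Polynomial K, ∀ s, u s = P.eval s

theorem isPolyFun_eval (P : Polynomial K) : IsPolyFun fun s => P.eval s := ⟨P, fun _ => rfl⟩

theorem isPolyFun_const (c : K) : IsPolyFun fun _ => c :=
  ⟨Polynomial.C c, fun _ => Polynomial.eval_C.symm⟩

theorem IsPolyFun.mul {u v : K → K} (hu : IsPolyFun u) (hv : IsPolyFun v) :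
    IsPolyFun fun s => u s * v s := by
  obtain ⟨P, hP⟩ := hu
  obtain ⟨Q, hQ⟩ := hv
  exact ⟨P * Q, fun s => by simp only [Polynomial.eval_mul, hP, hQ]⟩

theorem IsPolyFun.sum {ι : Type*} (S : Finset ι) {u : ι → K → K} (hu : ∀ i, IsPolyFun (u i)) :
    IsPolyFun fun s => ∑ i ∈ S, u i s := by
  choose P hP using hu
  exact ⟨∑ i ∈ S, P i, fun s => by
    rw [Polynomial.eval_finsetSum]
    exact Finset.sum_congr rfl fun i _ => hP i s⟩

theorem IsPolyFun.comp_const_add {u : K → K} (hu : IsPolyFun u) (c : K) :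
    IsPolyFun fun s => u (c + s) := by
  obtain ⟨P, hP⟩ := hu
  exact ⟨P.comp (Polynomial.C c + Polynomial.X), fun s => by simp [hP]⟩

theorem IsPolyFun.coeff_pow {F : K → PowerSeries K} (hF : ∀ n, IsPolyFun fun s => coeff n (F s))
    (k n : ℕ) : IsPolyFun fun s => coeff n (F s ^ k) := by
  induction k generalizing n with
  | zero => simpa using isPolyFun_const (coeff n (1 : PowerSeries K))
  | succ k ih =>
    simp_rw [pow_succ, PowerSeries.coeff_mul]
    exact IsPolyFun.sum _ fun ij => (ih ij.1).mul (hF ij.2)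

/-- Only positive integers are tested, because `F 0 = X` is not among the axioms of
`IsFractionalIteration`. -/
theorem polynomial_eq_of_eval_natCast_succ [CharZero K] {P Q : Polynomial K}
    (h : ∀ m : ℕ, P.eval ((m + 1 : ℕ) : K) = Q.eval ((m + 1 : ℕ) : K)) : P = Q := by
  refine Polynomial.eq_of_infinite_eval_eq _ _ (Set.Infinite.mono ?_ (Set.infinite_range_of_injective
    (f := fun m : ℕ => ((m + 1 : ℕ) : K)) fun a b hab => ?_))
  · rintro _ ⟨m, rfl⟩
    exact h m
  · simpa using hab

theorem IsPolyFun.ext [CharZero K] {u v : K → K} (hu : IsPolyFun u) (hv : IsPolyFun v)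
    (h : ∀ m : ℕ, u ((m + 1 : ℕ) : K) = v ((m + 1 : ℕ) : K)) (s : K) : u s = v s := by
  obtain ⟨P, hP⟩ := hu
  obtain ⟨Q, hQ⟩ := hv
  have hPQ : P = Q := polynomial_eq_of_eval_natCast_succ fun m => by rw [← hP, ← hQ, h m]
  rw [hP, hQ, hPQ]

/-! ### Fractional iterates -/

theorem IsFractionalIteration.represents [CharZero K] {f : PowerSeries K} {F : K → PowerSeries K}
    (hF : IsFractionalIteration f F) {φ : Module.End K (Polynomial K)} (hφ : Represents f φ)
    (m : ℕ) : Represents (F ((m + 1 : ℕ) : K)) (φ ^ (m + 1)) := by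
  induction m with
  | zero => simpa [hF.one] using hφ
  | succ m ih =>
    have hstep : F ((m + 1 + 1 : ℕ) : K) = PowerSeries.subst (F ((m + 1 : ℕ) : K)) f := by
      conv_rhs => rw [← hF.one]
      rw [hF.comp, Nat.cast_succ (m + 1), add_comm]
    rw [hstep, pow_succ']
    exact ih.subst (hF.constantCoeff_eq _) hφ

theorem IsFractionalIteration.unique [CharZero K] {f : PowerSeries K} {F G : K → PowerSeries K}
    (hF : IsFractionalIteration f F) (hG : IsFractionalIteration f G)
    {φ : Module.End K (Polynomial K)} (hφ : Represents f φ) : F = G := by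
  funext s
  ext n
  refine IsPolyFun.ext (hF.polynomial n) (hG.polynomial n) (fun m => ?_) s
  rw [(hF.represents hφ m).unique (hG.represents hφ m)]

theorem IsFractionalIteration.coeff_pow_eq [CharZero K] {f : PowerSeries K}
    {F : K → PowerSeries K} (hF : IsFractionalIteration f F) {φ : Module.End K (Polynomial K)}
    (hφ : Represents f φ) (hφ1 : Lowers 1 (φ - 1)) (s : K) (n k : ℕ) :
    (k.factorial : K)⁻¹ * coeff n (F s ^ k) =
      (n.factorial : K)⁻¹ * (deltaPoly φ n k).eval s := by
  refine IsPolyFun.ext ((isPolyFun_const _).mul (IsPolyFun.coeff_pow hF.polynomial k n))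
    ((isPolyFun_const _).mul (isPolyFun_eval _)) (fun m => ?_) s
  have hn : (n.factorial : K) ≠ 0 := Nat.cast_ne_zero.mpr n.factorial_ne_zero
  rw [eval_deltaPoly_natCast hφ1, hF.represents hφ m n k, mul_assoc, inv_mul_cancel_left₀ hn]

/-- The series `∑ₙ ([n, 1] of φ ^ s) xⁿ / n!`. -/
def iterates (φ : Module.End K (Polynomial K)) (s : K) : PowerSeries K :=
  PowerSeries.mk fun n => (n.factorial : K)⁻¹ * (deltaPoly φ n 1).eval s

theorem exists_represents_pow [CharZero K] {f : PowerSeries K} (hf : constantCoeff f = 0)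
    {φ : Module.End K (Polynomial K)} (hφ : Represents f φ) (m : ℕ) :
    ∃ a : PowerSeries K, constantCoeff a = 0 ∧ Represents a (φ ^ m) := by
  induction m with
  | zero => exact ⟨PowerSeries.X, by simp, by simpa using represents_X⟩
  | succ m ih =>
    obtain ⟨a, ha, haφ⟩ := ih
    refine ⟨a.subst f, PowerSeries.constantCoeff_subst_eq_zero hf _ ha, ?_⟩
    rw [pow_succ]
    exact hφ.subst hf haφ

/-- `iterates` only uses the entries with `k = 1`; the other `k` follow because some series
represents `φ ^ m`, and `k = 1` determines it. -/
theorem represents_iterates [CharZero K] {f : PowerSeries K} (hf : constantCoeff f = 0)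
    {φ : Module.End K (Polynomial K)} (hφ : Represents f φ) (hφ1 : Lowers 1 (φ - 1)) (m : ℕ) :
    Represents (iterates φ (m : K)) (φ ^ m) := by
  obtain ⟨a, -, haφ⟩ := exists_represents_pow hf hφ m
  convert haφ using 1
  ext n
  have hn : (n.factorial : K) ≠ 0 := Nat.cast_ne_zero.mpr n.factorial_ne_zero
  rw [iterates, PowerSeries.coeff_mk, eval_deltaPoly_natCast hφ1, haφ n 1]
  simp [hn]

theorem isPolyFun_coeff_iterates (φ : Module.End K (Polynomial K)) (n : ℕ) :
    IsPolyFun fun s => coeff n (iterates φ s) := by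
  simp only [iterates, PowerSeries.coeff_mk]
  exact (isPolyFun_const _).mul (isPolyFun_eval _)

theorem constantCoeff_iterates (φ : Module.End K (Polynomial K)) (s : K) :
    constantCoeff (iterates φ s) = 0 := by
  rw [← PowerSeries.coeff_zero_eq_constantCoeff_apply, iterates, PowerSeries.coeff_mk, deltaPoly]
  -- Here `0 - 1 = 0` in `ℕ`, so only `p = 0` remains, with entry `[0, 1]` of the identity.
  simp [opCoeff_one]

theorem iterates_subst [CharZero K] {f : PowerSeries K} (hf : constantCoeff f = 0)
    {φ : Module.End K (Polynomial K)} (hφ : Represents f φ) (hφ1 : Lowers 1 (φ - 1)) (r s : K) :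
    PowerSeries.subst (iterates φ s) (iterates φ r) = iterates φ (r + s) := by
  have hcoeff (r s : K) (n : ℕ) : coeff n (PowerSeries.subst (iterates φ s) (iterates φ r)) =
      ∑ d ∈ Finset.range (n + 1), coeff d (iterates φ r) * coeff n (iterates φ s ^ d) :=
    coeff_subst_eq_sum (constantCoeff_iterates φ s) _ (Nat.lt_succ_self n)
  have hleft (s : K) (n : ℕ) :
      IsPolyFun fun r => coeff n (PowerSeries.subst (iterates φ s) (iterates φ r)) := by
    simp only [hcoeff]
    exact IsPolyFun.sum _ fun d => (isPolyFun_coeff_iterates φ d).mul (isPolyFun_const _)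
  have hright (r : K) (n : ℕ) :
      IsPolyFun fun s => coeff n (PowerSeries.subst (iterates φ s) (iterates φ r)) := by
    simp only [hcoeff]
    exact IsPolyFun.sum _ fun d => (isPolyFun_const _).mul
      (IsPolyFun.coeff_pow (isPolyFun_coeff_iterates φ) d n)
  have hnat (a b : ℕ) : PowerSeries.subst (iterates φ (b : K)) (iterates φ (a : K)) =
      iterates φ ((a : K) + b) := by
    refine ((represents_iterates hf hφ hφ1 b).subst (constantCoeff_iterates φ _)
      (represents_iterates hf hφ hφ1 a)).unique ?_
    rw [← Nat.cast_add, ← pow_add]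
    exact represents_iterates hf hφ hφ1 (a + b)
  ext n
  -- Polynomiality in each variable separately suffices: first `r`, then `s`, is reduced to positive
  -- integers.
  refine IsPolyFun.ext (hleft s n) (v := fun r => coeff n (iterates φ (r + s))) ?_ (fun a => ?_) r
  · simp only [add_comm _ s]
    exact (isPolyFun_coeff_iterates φ n).comp_const_add s
  · refine IsPolyFun.ext (hright _ n) ((isPolyFun_coeff_iterates φ n).comp_const_add _)
      (fun b => ?_) s
    simp only [hnat]

theorem isFractionalIteration_iterates [CharZero K] {f : PowerSeries K}
    (hf : constantCoeff f = 0) {φ : Module.End K (Polynomial K)} (hφ : Represents f φ)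
    (hφ1 : Lowers 1 (φ - 1)) : IsFractionalIteration f (iterates φ) where
  constantCoeff_eq s := constantCoeff_iterates φ s
  one := by
    have h := represents_iterates hf hφ hφ1 1
    rw [Nat.cast_one, pow_one] at h
    exact h.unique hφ
  comp r s := iterates_subst hf hφ hφ1 r s
  polynomial := isPolyFun_coeff_iterates φ

/-! ### The iterative logarithm -/

theorem IsIterativeLog.coeff_eq [CharZero K] {F : K → PowerSeries K} {g : PowerSeries K}
    (hg : IsIterativeLog F g) {n : ℕ} {Q : Polynomial K} (hQ : ∀ s, coeff n (F s) = Q.eval s) :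
    coeff n g = (Polynomial.derivative Q).eval 0 := by
  obtain ⟨P, hP, hPg⟩ := hg n
  rw [hPg, polynomial_eq_of_eval_natCast_succ (P := P) (Q := Q) fun m => by rw [← hP, ← hQ]]

theorem existsUnique_isIterativeLog [CharZero K] {F : K → PowerSeries K}
    (hF : ∀ n, ∃ P : Polynomial K, ∀ s, coeff n (F s) = P.eval s) :
    ∃! g : PowerSeries K, IsIterativeLog F g := by
  choose P hP using hF
  refine ⟨PowerSeries.mk fun n => (Polynomial.derivative (P n)).eval 0, fun n =>
    ⟨P n, hP n, PowerSeries.coeff_mk _ _⟩, fun g hg => ?_⟩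
  ext n
  rw [PowerSeries.coeff_mk, hg.coeff_eq (hP n)]

theorem eval_zero_derivative_deltaPoly [CharZero K] (φ : Module.End K (Polynomial K)) (n : ℕ) :
    (Polynomial.derivative (deltaPoly φ n 1)).eval 0 = ∑ p ∈ Finset.Icc 1 (n - 1),
      (-1) ^ (p - 1) / (p : K) * opCoeff ((φ - 1) ^ p) n 1 := by
  rw [deltaPoly, Polynomial.derivative_sum, Polynomial.eval_finsetSum,
    ← Finset.insert_Icc_add_one_left_eq_Icc (Nat.zero_le _), Finset.sum_insert (by simp),
    choosePoly_zero]
  simp only [one_mul, Polynomial.derivative_C, Polynomial.eval_zero, zero_add]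
  refine Finset.sum_congr rfl fun p hp => ?_
  obtain ⟨q, rfl⟩ := Nat.exists_eq_add_of_le' (Finset.mem_Icc.mp hp).1
  rw [Polynomial.derivative_mul, Polynomial.derivative_C, mul_zero, add_zero, Polynomial.eval_mul,
    Polynomial.eval_C, eval_zero_derivative_choosePoly_succ, Nat.add_sub_cancel]

/-- For `p ≥ 1` the binomial `(s choose p)` vanishes at `0`, so the product rule leaves one term.
The term `p = 0` drops out since `[n, 1]` of the identity is `0` for `n ≥ 2`. -/
theorem eval_zero_derivative_powPoly [CharZero K] (φ : Module.End K (Polynomial K)) {n : ℕ}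
    (hn : 2 ≤ n) :
    (Polynomial.derivative (powPoly φ n 1)).eval 0 = ∑ p ∈ Finset.Icc 1 (n - 1),
      (-1) ^ (p - 1) / (p : K) * ((n - 1).choose p : K) * opCoeff (φ ^ p) n 1 := by
  rw [powPoly, Polynomial.derivative_sum, Polynomial.eval_finsetSum,
    ← Finset.insert_Icc_add_one_left_eq_Icc (Nat.zero_le _), Finset.sum_insert (by simp),
    pow_zero, opCoeff_one, if_neg (by omega)]
  simp only [Polynomial.C_0, mul_zero, Polynomial.derivative_zero, Polynomial.eval_zero, zero_add]
  refine Finset.sum_congr rfl fun p hp => ?_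
  have hpn := (Finset.mem_Icc.mp hp).2
  have hcast : (n : K) - (1 : ℕ) - 0 = ((n - 1 : ℕ) : K) := by
    rw [Nat.cast_sub (by omega), sub_zero]
  obtain ⟨q, rfl⟩ := Nat.exists_eq_add_of_le' (Finset.mem_Icc.mp hp).1
  rw [Polynomial.derivative_mul, Polynomial.derivative_C, mul_zero, add_zero, Polynomial.eval_mul,
    Polynomial.eval_C, Polynomial.derivative_mul, Polynomial.eval_add, Polynomial.eval_mul,
    Polynomial.eval_mul, eval_zero_choosePoly_succ, zero_mul, add_zero,
    eval_zero_derivative_choosePoly_succ, Nat.add_sub_cancel, Polynomial.eval_comp,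
    Polynomial.eval_sub, Polynomial.eval_C, Polynomial.eval_X, hcast, eval_choosePoly,
    Ring.choose_natCast, Nat.choose_symm hpn]

end Umbral

end

theorem mainTheorem1 {K : Type*} [Field K] [CharZero K]
    (f : PowerSeries K) (hf : Umbral.IsUnitary f)
    (φ : Module.End K (Polynomial K)) (hφ : Umbral.IsUmbral φ (Umbral.opD hf.compInv)) :
    (∃! F : K → PowerSeries K, Umbral.IsFractionalIteration f F) ∧
    ∀ F : K → PowerSeries K, Umbral.IsFractionalIteration f F →
      (∀ (s : K) (k : ℕ),
        ((k.factorial : K)⁻¹ • (F s) ^ k =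
          PowerSeries.mk fun n => if k ≤ n then
            (n.factorial : K)⁻¹ * ∑ p ∈ Finset.Icc 0 (n - k),
              Ring.choose s p * Umbral.opCoeff ((φ - 1) ^ p) n k
          else 0) ∧
        ((k.factorial : K)⁻¹ • (F s) ^ k =
          PowerSeries.mk fun n => if k ≤ n then
            (n.factorial : K)⁻¹ * ∑ p ∈ Finset.Icc 0 (n - k),
              Ring.choose s p * Ring.choose ((n : K) - k - s) (n - k - p) *
                Umbral.opCoeff (φ ^ p) n k
          else 0)) ∧
      (∃! g : PowerSeries K, Umbral.IsIterativeLog F g) ∧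
      ∀ g : PowerSeries K, Umbral.IsIterativeLog F g →
        (g = PowerSeries.mk fun n => if 2 ≤ n then
            (n.factorial : K)⁻¹ * ∑ p ∈ Finset.Icc 1 (n - 1),
              (-1) ^ (p - 1) / (p : K) * Umbral.opCoeff ((φ - 1) ^ p) n 1
          else 0) ∧
        (g = PowerSeries.mk fun n => if 2 ≤ n then
            (n.factorial : K)⁻¹ * ∑ p ∈ Finset.Icc 1 (n - 1),
              (-1) ^ (p - 1) / (p : K) * ((n - 1).choose p : K) *
                Umbral.opCoeff (φ ^ p) n 1
          else 0) := by
  have hrep : Umbral.Represents f φ := hφ.represents hf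
  have hlow : Umbral.Lowers 1 (φ - 1) := hrep.lowers_sub_one hf
  refine ⟨⟨Umbral.iterates φ,
    Umbral.isFractionalIteration_iterates hf.constantCoeff_eq hrep hlow,
    fun G hG => hG.unique
      (Umbral.isFractionalIteration_iterates hf.constantCoeff_eq hrep hlow) hrep⟩,
    fun F hF => ⟨fun s k => ?_, Umbral.existsUnique_isIterativeLog hF.polynomial,
      fun g hg => ?_⟩⟩
  · have hzero (n : ℕ) (h : ¬k ≤ n) :
        (k.factorial : K)⁻¹ * PowerSeries.coeff n (F s ^ k) = 0 := by
      rw [Umbral.coeff_pow_eq_zero_of_lt (hF.constantCoeff_eq s) (not_le.mp h), mul_zero]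
    constructor
    · ext n
      rw [PowerSeries.coeff_smul, smul_eq_mul, PowerSeries.coeff_mk]
      split_ifs with h
      · rw [hF.coeff_pow_eq hrep hlow, Umbral.eval_deltaPoly]
      · exact hzero n h
    · ext n
      rw [PowerSeries.coeff_smul, smul_eq_mul, PowerSeries.coeff_mk]
      split_ifs with h
      · rw [hF.coeff_pow_eq hrep hlow, ← Umbral.powPoly_eq_deltaPoly hlow h, Umbral.eval_powPoly]
      · exact hzero n h
  · have hcoeff (n : ℕ) : PowerSeries.coeff n g = (n.factorial : K)⁻¹ *
        (Polynomial.derivative (Umbral.deltaPoly φ n 1)).eval 0 := by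
      rw [hg.coeff_eq (Q := Polynomial.C (n.factorial : K)⁻¹ * Umbral.deltaPoly φ n 1),
        Polynomial.derivative_C_mul, Polynomial.eval_mul, Polynomial.eval_C]
      intro s
      rw [Polynomial.eval_mul, Polynomial.eval_C, ← hF.coeff_pow_eq hrep hlow s n 1]
      simp
    -- For `n = 0, 1` the truncated `n - 1` is `0`, so the sum is empty.
    have hzero (n : ℕ) (h : ¬2 ≤ n) : PowerSeries.coeff n g = 0 := by
      rw [hcoeff, Umbral.eval_zero_derivative_deltaPoly, Finset.Icc_eq_empty (by omega),
        Finset.sum_empty, mul_zero]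
    constructor
    · ext n
      rw [PowerSeries.coeff_mk]
      split_ifs with h
      · rw [hcoeff, Umbral.eval_zero_derivative_deltaPoly]
      · exact hzero n h
    · ext n
      rw [PowerSeries.coeff_mk]
      split_ifs with h
      · rw [hcoeff, ← Umbral.powPoly_eq_deltaPoly hlow (by omega),
          Umbral.eval_zero_derivative_powPoly φ h]
      · exact hzero n h
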